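/- **Stability of nominal dynamics.** Consider a microgrid with nodes $\mathcal M=\{1,\dots,n\}$ and lines $\{1,\dots,m\}$ without self-loops, each line arbitrarily oriented, with oriented incidence matrix $B\in\mathbb R^{m\times n}$. Let $r_E,L_E$ be the diagonal matrices of line resistances and inductances and $\omega_g$ the common frame frequency, and assume that every line $e$ is primarily inductive, $\omega_g L_e>r_e$. Let $\mathcal L=B^\top(-r_E+\omega_gL_E)^{-1}B$ be the network Laplacian. Node $i$ has capacitance $C_i>0$, nominal active and reactive power demand $\bar P_i,\bar Q_i\in\mathbb R$ and rated voltage $(z^o_{d,i},0)$. At voltage $(v_d,v_q)\neq 0$ its constant power load draws the current $g_i=(g_{d,i},g_{q,i})$, $$g_{d,i}(v_d,v_q)=\tfrac23\,\frac{v_d\bar P_i+v_q\bar Q_i}{v_d^2+v_q^2},\qquad g_{q,i}(v_d,v_q)=\tfrac23\,\frac{v_q\bar P_i-v_d\bar Q_i}{v_d^2+v_q^2}.$$ Let $\tilde z_{d},\tilde z_q\in\mathbb R^n$ be the deviations of the nominal voltages from the rated ones, with dynamics $$C_i\dot{\tilde z}_{d,i}=I_{d,i}+\omega_gC_i\tilde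 z_{q,i}-(\mathcal L^\top\tilde z_d)_i-g_{d,i}(\tilde z_{d,i}+z^o_{d,i},\tilde z_{q,i}),$$ $$C_i\dot{\tilde z}_{q,i}=I_{q,i}-\omega_gC_i(\tilde z_{d,i}+z^o_{d,i})-(\mathcal L^\top\tilde z_q)_i-g_{q,i}(\tilde z_{d,i}+z^o_{d,i},\tilde z_{q,i}),$$ under the nonlinear PI control law $$I_{d,i}=-K_{d,i}\tilde z_{d,i}+M_i\sigma_{d,i},\qquad I_{q,i}=-K_{q,i}\tilde z_{q,i}+\sigma_{q,i}+\omega_gC_i(\tilde z_{d,i}+z^o_{d,i})+g_{q,i}(\tilde z_{d,i}+z^o_{d,i},\tilde z_{q,i}),$$ $$\dot\sigma_{d,i}=k_{Id,i}(1-\sigma_{d,i}^2)(\hat z_{d,i}-\tilde z_{d,i}),\qquad \dot\sigma_{q,i}=-k_{Iq,i}\tilde z_{q,i},$$ with parameters $K_{d,i},k_{Id,i},M_i,K_{q,i},k_{Iq,i}>0$ and reference $\hat z_d\in\mathbb R^n$. Let $\hat x=(\hat z_d,\hat\sigma_d,0,0)$ be an equilibrium of this closed-loop network system in the coordinates $(\tilde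 z_d,\sigma_d,\tilde z_q,\sigma_q)$, with $\hat z_{d,i}+z^o_{d,i}\ne0$ and $\hat\sigma_{d,i}\in(-1,1)$ for all $i\in\mathcal M$. If $$K_{d,i}>\frac23\,\frac{\bar P_i}{(\hat z_{d,i}+z^o_{d,i})^2}\qquad\text{for all } i\in\mathcal M,$$ then the vector field of the system is differentiable at $\hat x$, its Jacobian at $\hat x$ is block upper triangular with respect to the partition $\big((\tilde z_d,\sigma_d),(\tilde z_q,\sigma_q)\big)$ and is Hurwitz (all its eigenvalues have negative real part), and $\hat x$ is locally asymptotically stable: for all initial states near $\hat x$ solutions exist for all $t\ge0$, solutions starting sufficiently near $\hat x$ stay as near to it as desired, and they converge to $\hat x$. -/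

import Mathlib

open Filter Topology

noncomputable section

namespace Microgrid

/-! ### Autonomous systems `x' = F x`: solutions, asymptotic stability, Hurwitz matrices -/

section Dynamics

variable {E : Type*} [NormedAddCommGroup E] [NormedSpace ℝ E]

/-- `x` solves `x' = F x` on the time set `I` (one-sided derivatives at end points of `I`). -/
def IsSolutionOn (F : E → E) (I : Set ℝ) (x : ℝ → E) : Prop :=
  ∀ t ∈ I, HasDerivWithinAt x (F (x t)) I t

/-- Lyapunov stability of the point `xe`. Near `xe` solutions exist for all future times, and every
solution that starts near `xe`, on however short a time interval it is given, remains near `xe`. -/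
def IsLyapunovStable (F : E → E) (xe : E) : Prop :=
  ∀ ε > 0, ∃ δ > 0, ∀ x₀ ∈ Metric.ball xe δ,
    (∃ x : ℝ → E, IsSolutionOn F (Set.Ici 0) x ∧ x 0 = x₀) ∧
    ∀ T > 0, ∀ x : ℝ → E, IsSolutionOn F (Set.Ico 0 T) x → x 0 = x₀ →
      ∀ t ∈ Set.Ico 0 T, x t ∈ Metric.ball xe ε

/-- Local attractivity: solutions starting near `xe` converge to `xe`. -/
def IsLocallyAttractive (F : E → E) (xe : E) : Prop :=
  ∃ δ > 0, ∀ x : ℝ → E, IsSolutionOn F (Set.Ici 0) x → x 0 ∈ Metric.ball xe δ →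
    Tendsto x atTop (𝓝 xe)

/-- `xe` is a locally asymptotically stable equilibrium of `x' = F x`. -/
def IsLocallyAsymptoticallyStable (F : E → E) (xe : E) : Prop :=
  F xe = 0 ∧ IsLyapunovStable F xe ∧ IsLocallyAttractive F xe

end Dynamics

/-- A real square matrix is Hurwitz if all its complex eigenvalues have negative real part. -/
def IsHurwitz {ι : Type*} [Fintype ι] [DecidableEq ι] (A : Matrix ι ι ℝ) : Prop :=
  ∀ μ ∈ spectrum ℂ (A.map (algebraMap ℝ ℂ)), μ.re < 0

/-- The Jacobian matrix of `F` at `x` (the matrix of the Fréchet derivative). -/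
def jacobian {ι : Type*} [Fintype ι] [DecidableEq ι] (F : (ι → ℝ) → (ι → ℝ)) (x : ι → ℝ) :
    Matrix ι ι ℝ :=
  LinearMap.toMatrix' (fderiv ℝ F x : (ι → ℝ) →ₗ[ℝ] (ι → ℝ))

/-! ### The network -/

/-- Data of a network with `n` nodes and `m` lines. Line `e` joins `src e` to `tgt e`
(arbitrary orientation). -/
structure Network (n m : ℕ) where
  /-- initial node of a line -/
  src : Fin m → Fin n
  /-- terminal node of a line -/
  tgt : Fin m → Fin n
  /-- line resistances -/
  r : Fin m → ℝ
  /-- line inductances -/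
  ind : Fin m → ℝ
  /-- common frequency of the rotating frame -/
  wg : ℝ
  /-- nodal capacitances -/
  C : Fin n → ℝ
  /-- nominal active power demands -/
  P : Fin n → ℝ
  /-- nominal reactive power demands -/
  Q : Fin n → ℝ
  /-- d-components of the rated nodal voltages (their q-components are zero) -/
  zo : Fin n → ℝ

/-- Tuning parameters of the nominal controller. -/
structure Gains (n : ℕ) where
  /-- proportional gains, d-component -/
  Kd : Fin n → ℝ
  /-- integral gains, d-component -/
  kId : Fin n → ℝ
  /-- input weights of the d-integrators -/
  M : Fin n → ℝ
  /-- proportional gains, q-component -/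
  Kq : Fin n → ℝ
  /-- integral gains, q-component -/
  kIq : Fin n → ℝ

/-- d-component of the current drawn by a constant power load `(P, Q)` at voltage `(vd, vq)`. -/
def loadD (vd vq P Q : ℝ) : ℝ :=
  2 / 3 * (vd / (vd ^ 2 + vq ^ 2) * P + vq / (vd ^ 2 + vq ^ 2) * Q)

/-- q-component of the current drawn by a constant power load `(P, Q)` at voltage `(vd, vq)`. -/
def loadQ (vd vq P Q : ℝ) : ℝ :=
  2 / 3 * (vq / (vd ^ 2 + vq ^ 2) * P - vd / (vd ^ 2 + vq ^ 2) * Q)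

/-- Index set of the network state: the blocks are `((z̃_d, σ_d), (z̃_q, σ_q))`. -/
abbrev StateIdx (n : ℕ) : Type := (Fin n ⊕ Fin n) ⊕ (Fin n ⊕ Fin n)

/-- Network states. -/
abbrev State (n : ℕ) : Type := StateIdx n → ℝ

/-- The state with blocks `z̃_d, σ_d, z̃_q, σ_q`. -/
def mkState {n : ℕ} (zd sd zq sq : Fin n → ℝ) : State n :=
  Sum.elim (Sum.elim zd sd) (Sum.elim zq sq)

namespace State

variable {n : ℕ} (x : State n)

/-- d-components `z̃_d` of the shifted nominal voltages. -/
def zd (i : Fin n) : ℝ := x (Sum.inl (Sum.inl i))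

/-- d-components `σ_d` of the integrator states. -/
def sd (i : Fin n) : ℝ := x (Sum.inl (Sum.inr i))

/-- q-components `z̃_q` of the shifted nominal voltages. -/
def zq (i : Fin n) : ℝ := x (Sum.inr (Sum.inl i))

/-- q-components `σ_q` of the integrator states. -/
def sq (i : Fin n) : ℝ := x (Sum.inr (Sum.inr i))

end State

namespace Network

variable {n m : ℕ} (N : Network n m) (G : Gains n)

/-- Oriented incidence matrix (lines × nodes). -/
def incidence : Matrix (Fin m) (Fin n) ℝ :=
  Matrix.of fun e i => if i = N.src e then 1 else if i = N.tgt e then -1 else 0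

/-- Network Laplacian `Bᵀ (-r_E + ω_g L_E)⁻¹ B`. -/
def laplacian : Matrix (Fin n) (Fin n) ℝ :=
  N.incidence.transpose * (-Matrix.diagonal N.r + N.wg • Matrix.diagonal N.ind)⁻¹ * N.incidence

/-- d-component of the nominal control current at node `i`. -/
def inputD (x : State n) (i : Fin n) : ℝ :=
  -G.Kd i * x.zd i + G.M i * x.sd i

/-- q-component of the nominal control current at node `i`; the last two terms cancel the
cross-coupling and the load current of the nodal q-dynamics. -/
def inputQ (x : State n) (i : Fin n) : ℝ :=
  -G.Kq i * x.zq i + x.sq i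
    + (N.wg * N.C i * (x.zd i + N.zo i) + loadQ (x.zd i + N.zo i) (x.zq i) (N.P i) (N.Q i))

/-- Right-hand side of the closed-loop nominal network dynamics, solved for the derivatives:
the shifted nodal voltage dynamics
`C z̃' = I + ω_g C J₂ (z̃ + z°) - 𝓛ᵀ z̃ - g (z̃ + z°, P, Q)`, with `J₂ = [0, 1; -1, 0]`, in closed
loop with the nominal control current `I` and its two integrators, where `zref` is the reference
for `z̃_d`. -/
def closedLoop (zref : Fin n → ℝ) (x : State n) : State n :=
  mkState
    (fun i => (N.C i)⁻¹ *
      (inputD G x i + N.wg * N.C i * x.zq i - N.laplacian.transpose.mulVec x.zd i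
        - loadD (x.zd i + N.zo i) (x.zq i) (N.P i) (N.Q i)))
    (fun i => G.kId i * (1 - x.sd i ^ 2) * (zref i - x.zd i))
    (fun i => (N.C i)⁻¹ *
      (N.inputQ G x i - N.wg * N.C i * (x.zd i + N.zo i) - N.laplacian.transpose.mulVec x.zq i
        - loadQ (x.zd i + N.zo i) (x.zq i) (N.P i) (N.Q i)))
    (fun i => -G.kIq i * x.zq i)

end Network

end Microgrid

end

/-!
The linearization of the closed loop is a cascade. In the `q`-block the controller cancels the
cross-coupling and the load current, so that this block is the linear proportional-integral loop
`C z' = -(K_q + 𝓛ᵀ) z + s`, `s' = -k_{Iq} z`. It drives the `d`-block, which is a loop of the same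
kind, with proportional gain `K_d - 2/3 P / (ẑ_d + z°)²` (the constant power load acts as a negative
resistance) and integral gain `k_{Id} (1 - σ̂_d²)`. All these gains are positive, and `𝓛ᵀ` is
positive semidefinite because every line weight `ω_g L_e - r_e` is positive.

Everything is derived from one strict quadratic Lyapunov function (`HasLyapunovForm`) of the
linearization. For a single loop, the energy has a derivative that is only semidefinite, and
subtracting a small multiple of the cross term `∑ C z s` makes it definite
(`hasLyapunovForm_piLoop`). For the cascade, the form of the driving block dominates a small multiple
of the form of the driven one (`HasLyapunovForm.cascade`). Both smallness arguments are instances of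
Finsler's lemma (`eventually_pos_add_mul`).

A strict Lyapunov form forces every complex eigenvalue into the left half plane
(`HasLyapunovForm.isHurwitz`). It is also a local Lyapunov function of the `C¹` nonlinear field,
decaying exponentially on small sublevel sets by a fencing argument (`lyapunov_le_exp`). Solutions
starting there are global, since they cannot leave a ball on which the field agrees with a bounded
Lipschitz one (`HasLyapunovForm.isLocallyAsymptoticallyStable`).
-/

noncomputable section

namespace Microgrid

/-! ### Quadratic forms on finite-dimensional spaces -/

section Forms

variable {E : Type*} [NormedAddCommGroup E] [NormedSpace ℝ E]

/-- **Finsler's lemma**, in the form that perturbs a positive semidefinite form `q₀` by a form `q₁`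
that is positive on the nonzero zeros of `q₀`. It is stated for functions that are continuous and
homogeneous of degree two, so that it applies to `v ↦ B v (A v)` without symmetrization. -/
theorem eventually_pos_add_mul [FiniteDimensional ℝ E] {q₀ q₁ : E → ℝ}
    (hc₀ : Continuous q₀) (hc₁ : Continuous q₁)
    (hh₀ : ∀ (a : ℝ) v, q₀ (a • v) = a ^ 2 * q₀ v)
    (hh₁ : ∀ (a : ℝ) v, q₁ (a • v) = a ^ 2 * q₁ v)
    (hq₀ : ∀ v, 0 ≤ q₀ v) (hq₁ : ∀ v, v ≠ 0 → q₀ v = 0 → 0 < q₁ v) :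
    ∀ᶠ ε in 𝓝[>] (0 : ℝ), ∀ v, v ≠ 0 → 0 < q₀ v + ε * q₁ v := by
  -- By homogeneity it is enough to treat the unit sphere, which is compact.
  have key : ∀ᶠ ε in 𝓝 (0 : ℝ), ∀ v ∈ Metric.sphere (0 : E) 1, 0 < ε → 0 < q₀ v + ε * q₁ v := by
    refine (isCompact_sphere (0 : E) 1).eventually_forall_of_forall_eventually fun v hv => ?_
    have hv0 : v ≠ 0 := by
      rintro rfl
      simp at hv
    rcases (hq₀ v).eq_or_lt with h | h
    · have h1 : ∀ᶠ z : ℝ × E in 𝓝 (0, v), 0 < q₁ z.2 :=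
        (hc₁.comp continuous_snd).continuousAt.eventually (lt_mem_nhds (hq₁ v hv0 h.symm))
      filter_upwards [h1] with z hz hε
      exact add_pos_of_nonneg_of_pos (hq₀ _) (mul_pos hε hz)
    · have hcont : Continuous fun z : ℝ × E => q₀ z.2 + z.1 * q₁ z.2 := by fun_prop
      have h1 : ∀ᶠ z : ℝ × E in 𝓝 (0, v), 0 < q₀ z.2 + z.1 * q₁ z.2 :=
        hcont.continuousAt.eventually (lt_mem_nhds (by simpa using h))
      filter_upwards [h1] with z hz _
      exact hz
  filter_upwards [key.filter_mono nhdsWithin_le_nhds, self_mem_nhdsWithin] with ε hε hpos v hv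
  have hn : 0 < ‖v‖ := norm_pos_iff.mpr hv
  have h := hε (‖v‖⁻¹ • v) (by simp [norm_smul, hn.ne']) hpos
  rw [hh₀, hh₁] at h
  have h2 : 0 < (‖v‖⁻¹) ^ 2 * (q₀ v + ε * q₁ v) := by linarith
  exact pos_of_mul_pos_right h2 (by positivity)

theorem exists_mul_norm_sq_le [FiniteDimensional ℝ E] {q : E → ℝ} (hc : Continuous q)
    (hh : ∀ (a : ℝ) v, q (a • v) = a ^ 2 * q v) (hq : ∀ v, v ≠ 0 → 0 < q v) :
    ∃ c > 0, ∀ v, c * ‖v‖ ^ 2 ≤ q v := by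
  have h0 : q 0 = 0 := by simpa using hh 0 0
  -- `‖v‖ ^ 2` need not be quadratic, but it is continuous and homogeneous of degree two.
  have h := eventually_pos_add_mul (q₁ := fun v => -‖v‖ ^ 2) hc (by fun_prop) hh
    (fun a v => by simp [norm_smul, mul_pow])
    (fun v => by
      rcases eq_or_ne v 0 with rfl | hv
      · exact h0.ge
      · exact (hq v hv).le)
    (fun v hv h => absurd h (hq v hv).ne')
  obtain ⟨c, hc', hpos⟩ := (h.and self_mem_nhdsWithin).exists
  refine ⟨c, hpos, fun v => ?_⟩
  rcases eq_or_ne v 0 with rfl | hv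
  · simp [h0]
  · have := hc' v hv
    linarith

/-! ### Strict quadratic Lyapunov functions of linear systems -/

/-- `A` has a strict quadratic Lyapunov function `v ↦ B v v`: a positive definite symmetric form
that decreases strictly along the nonzero solutions of `v' = A v`. -/
def HasLyapunovForm (A : E →L[ℝ] E) : Prop :=
  ∃ B : E →L[ℝ] E →L[ℝ] ℝ, (∀ v w, B v w = B w v) ∧ (∀ v, v ≠ 0 → 0 < B v v) ∧
    ∀ v, v ≠ 0 → B v (A v) < 0

variable {E₁ E₂ : Type*} [NormedAddCommGroup E₁] [NormedSpace ℝ E₁]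
  [NormedAddCommGroup E₂] [NormedSpace ℝ E₂]

theorem HasLyapunovForm.of_injective {A : E →L[ℝ] E} {A₁ : E₁ →L[ℝ] E₁} (h : HasLyapunovForm A₁)
    (J : E →L[ℝ] E₁) (hJ : Function.Injective J) (hA : ∀ v, J (A v) = A₁ (J v)) :
    HasLyapunovForm A := by
  obtain ⟨B, hs, hp, hn⟩ := h
  have hJ0 : ∀ v, v ≠ 0 → J v ≠ 0 := fun v hv => by
    rwa [Ne, map_eq_zero_iff J hJ]
  refine ⟨B.bilinearComp J J, fun v w => ?_, fun v hv => ?_, fun v hv => ?_⟩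
  · simpa using hs _ _
  · simpa using hp _ (hJ0 v hv)
  · simpa [hA] using hn _ (hJ0 v hv)

/-- The block triangular map `(v, w) ↦ (A₁ v + X w, A₂ w)`. -/
def cascade (A₁ : E₁ →L[ℝ] E₁) (X : E₂ →L[ℝ] E₁) (A₂ : E₂ →L[ℝ] E₂) :
    E₁ × E₂ →L[ℝ] E₁ × E₂ :=
  (A₁.coprod X).prod (A₂.comp (ContinuousLinearMap.snd ℝ E₁ E₂))

/-- Lyapunov forms `B₁`, `B₂` of the diagonal blocks combine to the form `B₂ + ε B₁`: for small
`ε > 0` the decay of `B₂` dominates the contribution of the coupling `X`. -/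
theorem HasLyapunovForm.cascade [FiniteDimensional ℝ E₁] [FiniteDimensional ℝ E₂]
    {A₁ : E₁ →L[ℝ] E₁} {A₂ : E₂ →L[ℝ] E₂} (h₁ : HasLyapunovForm A₁) (h₂ : HasLyapunovForm A₂)
    (X : E₂ →L[ℝ] E₁) : HasLyapunovForm (cascade A₁ X A₂) := by
  obtain ⟨B₁, hs₁, hp₁, hn₁⟩ := h₁
  obtain ⟨B₂, hs₂, hp₂, hn₂⟩ := h₂
  have hn₂' : ∀ w, 0 ≤ -B₂ w (A₂ w) := fun w => by
    rcases eq_or_ne w 0 with rfl | hw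
    · simp
    · exact (neg_pos.mpr (hn₂ w hw)).le
  have h := eventually_pos_add_mul (E := E₁ × E₂) (q₀ := fun v => -B₂ v.2 (A₂ v.2))
    (q₁ := fun v => -B₁ v.1 (A₁ v.1 + X v.2)) (by fun_prop) (by fun_prop)
    (fun a v => by simp; ring) (fun a v => by simp; ring) (fun v => hn₂' v.2)
    (fun v hv h => by
      have hw : v.2 = 0 := by
        by_contra hw
        exact (hn₂ _ hw).ne (neg_eq_zero.mp h)
      have hv1 : v.1 ≠ 0 := fun h1 => hv (Prod.ext h1 hw)
      simpa [hw] using hn₁ _ hv1)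
  obtain ⟨ε, hε, hpos⟩ := (h.and self_mem_nhdsWithin).exists
  have hpos : 0 < ε := hpos
  refine ⟨B₂.bilinearComp (.snd ℝ E₁ E₂) (.snd ℝ E₁ E₂) +
    ε • B₁.bilinearComp (.fst ℝ E₁ E₂) (.fst ℝ E₁ E₂), fun v w => ?_, fun v hv => ?_,
    fun v hv => ?_⟩
  · simp [hs₁ v.1, hs₂ v.2]
  · have h1 : 0 ≤ B₁ v.1 v.1 := by
      rcases eq_or_ne v.1 0 with h | h
      · simp [h]
      · exact (hp₁ _ h).le
    simp only [add_apply, smul_apply, ContinuousLinearMap.bilinearComp_apply,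
      ContinuousLinearMap.coe_snd', ContinuousLinearMap.coe_fst', smul_eq_mul]
    rcases eq_or_ne v.2 0 with h | h
    · have hv1 : v.1 ≠ 0 := fun h1 => hv (Prod.ext h1 h)
      have := mul_pos hpos (hp₁ _ hv1)
      simpa [h] using this
    · have := hp₂ _ h
      positivity
  · have := hε v hv
    simp [Microgrid.cascade]
    simp at this
    linarith

/-- The form `(v, w) ↦ ∑ i, c i * v i * w i`. -/
def diagForm {ι : Type*} [Fintype ι] (c : ι → ℝ) : (ι → ℝ) →L[ℝ] (ι → ℝ) →L[ℝ] ℝ :=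
  ∑ i, c i • (ContinuousLinearMap.proj (R := ℝ) (φ := fun _ : ι => ℝ) i).smulRight
    (ContinuousLinearMap.proj (R := ℝ) (φ := fun _ : ι => ℝ) i)

theorem diagForm_apply {ι : Type*} [Fintype ι] (c v w : ι → ℝ) :
    diagForm c v w = ∑ i, c i * (v i * w i) := by
  simp [diagForm]

theorem diagForm_self_pos {ι : Type*} [Fintype ι] {c v : ι → ℝ} (hc : ∀ i, 0 < c i) (hv : v ≠ 0) :
    0 < diagForm c v v := by
  rw [diagForm_apply]
  obtain ⟨j, hj⟩ := Function.ne_iff.mp hv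
  refine Finset.sum_pos' (fun i _ => mul_nonneg (hc i).le (mul_self_nonneg _))
    ⟨j, Finset.mem_univ _, mul_pos (hc j) (mul_self_pos.mpr hj)⟩

/-- The linear proportional-integral loop `C z' = -A z + D s`, `s' = -E z`, where `C`, `D`, `E` are
diagonal matrices. -/
def piLoop {ι : Type*} [Fintype ι] (C D E : ι → ℝ) (A : Matrix ι ι ℝ) :
    (ι → ℝ) × (ι → ℝ) →L[ℝ] (ι → ℝ) × (ι → ℝ) :=
  LinearMap.toContinuousLinearMap
    { toFun := fun v => (fun i => (C i)⁻¹ * (-A.mulVec v.1 i + D i * v.2 i), fun i => -E i * v.1 i)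
      map_add' := fun v w => by
        ext i <;> simp [Matrix.mulVec_add] <;> ring
      map_smul' := fun a v => by
        ext i <;> simp [Matrix.mulVec_smul] <;> ring }

/-- The energy `∑ C z² + ∑ (D / E) s²` decreases at the rate `z ⬝ A z` only, which does not see
`s`. Subtracting a small multiple of the cross term `∑ C z s` makes the decrease strict. -/
theorem hasLyapunovForm_piLoop {ι : Type*} [Fintype ι] {C D E : ι → ℝ} {A : Matrix ι ι ℝ}
    (hC : ∀ i, 0 < C i) (hD : ∀ i, 0 < D i) (hE : ∀ i, 0 < E i)
    (hA : ∀ z, z ≠ 0 → 0 < ∑ i, z i * A.mulVec z i) : HasLyapunovForm (piLoop C D E A) := by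
  have hA' : ∀ z, 0 ≤ ∑ i, z i * A.mulVec z i := fun z => by
    rcases eq_or_ne z 0 with rfl | hz
    · simp
    · exact (hA z hz).le
  have hDE : ∀ i, 0 < D i / E i := fun i => div_pos (hD i) (hE i)
  let p₁ := ContinuousLinearMap.fst ℝ (ι → ℝ) (ι → ℝ)
  let p₂ := ContinuousLinearMap.snd ℝ (ι → ℝ) (ι → ℝ)
  let B₀ : (ι → ℝ) × (ι → ℝ) →L[ℝ] (ι → ℝ) × (ι → ℝ) →L[ℝ] ℝ :=
    (diagForm C).bilinearComp p₁ p₁ + (diagForm fun i => D i / E i).bilinearComp p₂ p₂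
  let B₁ : (ι → ℝ) × (ι → ℝ) →L[ℝ] (ι → ℝ) × (ι → ℝ) →L[ℝ] ℝ :=
    (diagForm C).bilinearComp p₁ p₂ + (diagForm C).bilinearComp p₂ p₁
  have hB₀ : ∀ v w, B₀ v w = ∑ i, (C i * (v.1 i * w.1 i) + D i / E i * (v.2 i * w.2 i)) :=
    fun v w => by simp [B₀, p₁, p₂, diagForm_apply, Finset.sum_add_distrib]
  have hB₁ : ∀ v w, B₁ v w = ∑ i, C i * (v.1 i * w.2 i + v.2 i * w.1 i) :=
    fun v w => by simp [B₁, p₁, p₂, diagForm_apply, Finset.sum_add_distrib, mul_add]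
  have hB₀pos : ∀ v, v ≠ 0 → 0 < B₀ v v := fun v hv => by
    have h1 : 0 ≤ diagForm C v.1 v.1 := by
      rcases eq_or_ne v.1 0 with h | h
      · simp [h]
      · exact (diagForm_self_pos hC h).le
    have h2 : B₀ v v = diagForm C v.1 v.1 + diagForm (fun i => D i / E i) v.2 v.2 := rfl
    rw [h2]
    rcases eq_or_ne v.2 0 with h | h
    · have hv1 : v.1 ≠ 0 := fun h1 => hv (Prod.ext h1 h)
      simpa [h] using diagForm_self_pos hC hv1
    · exact add_pos_of_nonneg_of_pos h1 (diagForm_self_pos hDE h)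
  have hB₀A : ∀ v, B₀ v (piLoop C D E A v) = -∑ i, v.1 i * A.mulVec v.1 i := fun v => by
    rw [hB₀, ← Finset.sum_neg_distrib]
    refine Finset.sum_congr rfl fun i _ => ?_
    have := (hC i).ne'
    have := (hE i).ne'
    simp [piLoop]
    field_simp
    ring
  have hpos : ∀ᶠ ε in 𝓝[>] (0 : ℝ), ∀ v, v ≠ 0 → 0 < B₀ v v + ε * -B₁ v v :=
    eventually_pos_add_mul (by fun_prop) (by fun_prop) (fun a v => by simp; ring)
      (fun a v => by simp; ring)
      (fun v => by
        rcases eq_or_ne v 0 with rfl | h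
        · simp
        · exact (hB₀pos v h).le)
      (fun v hv h => absurd h (hB₀pos v hv).ne')
  have hneg : ∀ᶠ ε in 𝓝[>] (0 : ℝ), ∀ v, v ≠ 0 →
      0 < -B₀ v (piLoop C D E A v) + ε * B₁ v (piLoop C D E A v) :=
    eventually_pos_add_mul (by fun_prop) (by fun_prop) (fun a v => by simp; ring)
      (fun a v => by simp; ring)
      (fun v => by
        rw [hB₀A, neg_neg]
        exact hA' _)
      (fun v hv h => by
        have hz : v.1 = 0 := by
          by_contra hz
          rw [hB₀A, neg_neg] at h
          exact (hA _ hz).ne' h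
        have hs : v.2 ≠ 0 := fun h2 => hv (Prod.ext hz h2)
        have : B₁ v (piLoop C D E A v) = diagForm D v.2 v.2 := by
          rw [hB₁, diagForm_apply]
          refine Finset.sum_congr rfl fun i _ => ?_
          have := (hC i).ne'
          simp [piLoop, hz]
          field_simp
        rw [this]
        exact diagForm_self_pos hD hs)
  obtain ⟨ε, hε₁, hε₂⟩ := (hpos.and hneg).exists
  refine ⟨B₀ - ε • B₁, fun v w => ?_, fun v hv => ?_, fun v hv => ?_⟩
  · simp only [sub_apply, smul_apply, hB₀, hB₁]
    congr 1
    · exact Finset.sum_congr rfl fun i _ => by ring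
    · exact congrArg (ε • ·) (Finset.sum_congr rfl fun i _ => by ring)
  · have := hε₁ v hv
    simp only [sub_apply, smul_apply, smul_eq_mul]
    linarith
  · have := hε₂ v hv
    simp only [sub_apply, smul_apply, smul_eq_mul]
    linarith

end Forms

/-- The real and imaginary parts `x`, `y` of an eigenvector for `μ` satisfy
`B x (A x) + B y (A y) = μ.re * (B x x + B y y)`. -/
theorem HasLyapunovForm.isHurwitz {ι : Type*} [Fintype ι] [DecidableEq ι]
    {A : (ι → ℝ) →L[ℝ] (ι → ℝ)} (h : HasLyapunovForm A) :
    IsHurwitz (LinearMap.toMatrix' (A : (ι → ℝ) →ₗ[ℝ] (ι → ℝ))) := by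
  obtain ⟨B, hs, hp, hn⟩ := h
  intro μ hμ
  rw [← Matrix.spectrum_toLin', ← Module.End.hasEigenvalue_iff_mem_spectrum] at hμ
  obtain ⟨v, hv⟩ := hμ.exists_hasEigenvector
  have hv0 := hv.2
  have hAv := hv.apply_eq_smul
  set x : ι → ℝ := fun i => (v i).re with hx
  set y : ι → ℝ := fun i => (v i).im with hy
  set M := LinearMap.toMatrix' (A : (ι → ℝ) →ₗ[ℝ] (ι → ℝ)) with hM
  have hMA : ∀ w, M.mulVec w = A w := fun w => by
    rw [hM, LinearMap.toMatrix'_mulVec]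
    rfl
  have hAx : A x = μ.re • x - μ.im • y := by
    rw [← hMA]
    ext i
    have := congrArg Complex.re (congrFun hAv i)
    simpa [Matrix.mulVec, dotProduct, Matrix.toLin'_apply] using this
  have hAy : A y = μ.im • x + μ.re • y := by
    rw [← hMA]
    ext i
    have := congrArg Complex.im (congrFun hAv i)
    simpa [Matrix.mulVec, dotProduct, Matrix.toLin'_apply, add_comm] using this
  have key : B x (A x) + B y (A y) = μ.re * (B x x + B y y) := by
    rw [hAx, hAy]
    simp [hs y x]
    ring
  have hle : ∀ w, 0 ≤ B w w ∧ B w (A w) ≤ 0 := fun w => by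
    rcases eq_or_ne w 0 with rfl | hw
    · simp
    · exact ⟨(hp w hw).le, (hn w hw).le⟩
  have hxy : x ≠ 0 ∨ y ≠ 0 := by
    by_contra! hc
    refine hv0 (funext fun i => Complex.ext ?_ ?_)
    · exact congrFun hc.1 i
    · exact congrFun hc.2 i
  have h1 : 0 < B x x + B y y := by
    rcases hxy with h | h
    · linarith [hp _ h, (hle y).1]
    · linarith [hp _ h, (hle x).1]
  have h2 : B x (A x) + B y (A y) < 0 := by
    rcases hxy with h | h
    · linarith [hn _ h, (hle y).2]
    · linarith [hn _ h, (hle x).2]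
  rw [key] at h2
  exact (neg_iff_pos_of_mul_neg h2).mpr h1

/-! ### Lyapunov's indirect method -/

section Stability

variable {E : Type*} [NormedAddCommGroup E] [NormedSpace ℝ E]

theorem IsSolutionOn.mono {F : E → E} {I J : Set ℝ} {x : ℝ → E} (h : IsSolutionOn F I x)
    (hJ : J ⊆ I) : IsSolutionOn F J x :=
  fun t ht => (h t (hJ ht)).mono hJ

/-- A bounded Lipschitz vector field has global solutions: the Picard-Lindelöf theorem applies on
every interval `[-T, T]`, on a ball of radius `L * T`, and uniqueness glues the solutions. -/
theorem exists_isSolutionOn_of_lipschitzWith_of_bounded [CompleteSpace E] {F : E → E} {K L : NNReal}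
    (hF : LipschitzWith K F) (hL : ∀ x, ‖F x‖ ≤ L) (x₀ : E) :
    ∃ x : ℝ → E, IsSolutionOn F (Set.Ici 0) x ∧ x 0 = x₀ := by
  have hloc : ∀ k : ℕ, ∃ α : ℝ → E, α 0 = x₀ ∧
      ∀ t ∈ Set.Ioo (-(k + 1 : ℝ)) (k + 1), HasDerivAt α (F (α t)) t := by
    intro k
    have h0 : (0 : ℝ) ∈ Set.Icc (-(k + 1 : ℝ)) (k + 1) := ⟨by linarith [k.cast_nonneg (α := ℝ)],
      by positivity⟩
    have hpl : IsPicardLindelof (fun _ : ℝ => F) (⟨0, h0⟩ : Set.Icc (-(k + 1 : ℝ)) (k + 1)) x₀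
        (L * (k + 1)) 0 L K :=
      { lipschitzOnWith := fun _ _ => hF.lipschitzOnWith
        continuousOn := fun _ _ => continuousOn_const
        norm_le := fun _ _ x _ => hL x
        mul_max_le := by simp }
    obtain ⟨α, hα0, hα⟩ := hpl.exists_eq_forall_mem_Icc_hasDerivWithinAt₀
    exact ⟨α, hα0, fun t ht => (hα t (Set.Ioo_subset_Icc_self ht)).hasDerivAt
      (Icc_mem_nhds ht.1 ht.2)⟩
  choose α hα0 hα using hloc
  have hglue : ∀ j k : ℕ, j ≤ k →
      Set.EqOn (α j) (α k) (Set.Ioo (-(j + 1 : ℝ)) (j + 1)) := by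
    intro j k hjk
    have hjk' : (j : ℝ) ≤ k := by exact_mod_cast hjk
    refine ODE_solution_unique_of_mem_Ioo (v := fun _ => F) (s := fun _ => Set.univ) (t₀ := 0)
      (fun t _ => hF.lipschitzOnWith) ⟨by linarith [j.cast_nonneg (α := ℝ)], by positivity⟩
      (fun t ht => ⟨hα j t ht, trivial⟩) (fun t ht => ⟨hα k t ?_, trivial⟩)
      ((hα0 j).trans (hα0 k).symm)
    exact ⟨by linarith [ht.1], by linarith [ht.2]⟩
  refine ⟨fun t => α ⌈|t|⌉₊ t, fun t _ => ?_, by simp [hα0]⟩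
  have hmem : ∀ s : ℝ, s ∈ Set.Ioo (-(⌈|s|⌉₊ + 1 : ℝ)) (⌈|s|⌉₊ + 1) := fun s => by
    have := Nat.le_ceil |s|
    exact abs_lt.mp (by linarith)
  -- Near `t` the glued curve agrees with the solution on an interval that is larger by one.
  set N := ⌈|t|⌉₊ + 1 with hN
  have heq : ∀ s ∈ Set.Ioo (-(N : ℝ)) N, α ⌈|s|⌉₊ s = α N s := fun s hs =>
    hglue _ _ (Nat.ceil_le.mpr (abs_lt.mpr hs).le) (hmem s)
  have ht : t ∈ Set.Ioo (-(N : ℝ)) N := by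
    have := hmem t
    push_cast [hN]
    exact this
  have hd : HasDerivAt (α N) (F (α N t)) t :=
    hα N t ⟨by linarith [ht.1], by linarith [ht.2]⟩
  have hev : (fun s => α ⌈|s|⌉₊ s) =ᶠ[𝓝 t] α N := by
    filter_upwards [Ioo_mem_nhds ht.1 ht.2] with s hs
    exact heq s hs
  have := hd.congr_of_eventuallyEq hev
  rw [← heq t ht] at this
  exact this.hasDerivWithinAt

/-- Exponential decay of a quadratic Lyapunov function along solutions. The decay estimate is only
assumed on the sublevel set of `ℓ`, which solutions cannot leave. -/
theorem lyapunov_le_exp {F : E → E} {xe : E} {B : E →L[ℝ] E →L[ℝ] ℝ} (hs : ∀ v w, B v w = B w v)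
    {κ ℓ : ℝ} (hκ : 0 ≤ κ) (hℓ : 0 < ℓ)
    (hdec : ∀ x, 0 < B (x - xe) (x - xe) → B (x - xe) (x - xe) ≤ ℓ →
      2 * B (x - xe) (F x) < -κ * B (x - xe) (x - xe))
    {T : ℝ} {x : ℝ → E} (hx : IsSolutionOn F (Set.Ico 0 T) x)
    (h0 : B (x 0 - xe) (x 0 - xe) ≤ ℓ) {t : ℝ} (ht : t ∈ Set.Ico 0 T) :
    B (x t - xe) (x t - xe) ≤ ℓ * Real.exp (-κ * t) := by
  have hderiv : ∀ s ∈ Set.Ico 0 T, HasDerivWithinAt (fun s => B (x s - xe) (x s - xe))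
      (2 * B (x s - xe) (F (x s))) (Set.Ico 0 T) s := fun s hs' => by
    have h1 := (hx s hs').sub_const xe
    have h2 := B.hasFDerivAt.comp_hasDerivWithinAt s h1
    have h3 := h2.clm_apply h1
    refine h3.congr_deriv ?_
    simp only [Function.comp_apply]
    rw [hs (F (x s)) (x s - xe)]
    ring
  have hsub : Set.Icc 0 t ⊆ Set.Ico 0 T := fun s hs' => ⟨hs'.1, hs'.2.trans_lt ht.2⟩
  have hexp : ∀ s : ℝ, HasDerivAt (fun s => ℓ * Real.exp (-κ * s))
      (-κ * (ℓ * Real.exp (-κ * s))) s := fun s => by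
    have := (((hasDerivAt_id s).const_mul (-κ)).exp).const_mul ℓ
    refine this.congr_deriv ?_
    simp
    ring
  refine image_le_of_deriv_right_lt_deriv_boundary' (a := 0) (b := t)
    (fun s hs' => ((hderiv s (hsub hs')).continuousWithinAt).mono hsub)
    (fun s hs' => (hderiv s ⟨hs'.1, hs'.2.trans ht.2⟩).mono_of_mem_nhdsWithin ?_)
    (by simpa using h0) (fun s _ => (hexp s).continuousAt.continuousWithinAt)
    (fun s _ => (hexp s).hasDerivWithinAt) (fun s hs' heq => ?_) ⟨ht.1, le_rfl⟩
  · exact mem_of_superset (Ico_mem_nhdsGE (hs'.2.trans ht.2)) (Set.Ico_subset_Ico_left hs'.1)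
  · have hpos : 0 < ℓ * Real.exp (-κ * s) := mul_pos hℓ (Real.exp_pos _)
    have hle : ℓ * Real.exp (-κ * s) ≤ ℓ :=
      mul_le_of_le_one_right hℓ.le (Real.exp_le_one_iff.mpr (by nlinarith [hs'.1]))
    have := hdec (x s) (heq ▸ hpos) (heq ▸ hle)
    rwa [heq] at this

/-- **Lyapunov's indirect method**: near an equilibrium, a `C¹` vector field inherits a strict
quadratic Lyapunov function from its linearization. Solutions that start close enough are
global because they solve, inside a ball, the equation for a compactly supported `C¹` field. -/
theorem HasLyapunovForm.isLocallyAsymptoticallyStable [FiniteDimensional ℝ E] {F : E → E} {xe : E}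
    (hF : ContDiffAt ℝ 1 F xe) (h0 : F xe = 0) (h : HasLyapunovForm (fderiv ℝ F xe)) :
    IsLocallyAsymptoticallyStable F xe := by
  obtain ⟨B, hs, hp, hn⟩ := h
  set A := fderiv ℝ F xe with hA
  have hFA : HasFDerivAt F A xe := (hF.differentiableAt one_ne_zero).hasFDerivAt
  obtain ⟨c, hc, hcB⟩ := exists_mul_norm_sq_le (q := fun v => B v v) (by fun_prop)
    (fun a v => by simp; ring) hp
  obtain ⟨d, hd, hdB⟩ := exists_mul_norm_sq_le (q := fun v => -B v (A v)) (by fun_prop)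
    (fun a v => by simp; ring) (fun v hv => neg_pos.mpr (hn v hv))
  have hBle : ∀ v w, B v w ≤ (‖B‖ + 1) * ‖v‖ * ‖w‖ := fun v w => by
    have h1 := (Real.le_norm_self _).trans (B.le_opNorm₂ v w)
    have h2 : 0 ≤ ‖v‖ * ‖w‖ := by positivity
    nlinarith
  set b := ‖B‖ + 1 with hb
  have hb0 : 0 < b := by positivity
  set κ := d / (2 * b) with hκ
  have hκ0 : 0 < κ := by positivity
  -- The linearization error costs at most half of the decay rate `d`.
  have hnear : ∀ᶠ x in 𝓝 xe, 0 < B (x - xe) (x - xe) →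
      2 * B (x - xe) (F x) < -κ * B (x - xe) (x - xe) := by
    have ho := hFA.isLittleO.def (show 0 < d / (2 * b) by positivity)
    filter_upwards [ho] with x hx hpos
    rw [h0, sub_zero] at hx
    set v := x - xe
    have hv : 0 < ‖v‖ := norm_pos_iff.mpr fun hv => by simp [hv] at hpos
    have e1 : B v (F x) = B v (A v) + B v (F x - A v) := by rw [← map_add]; simp
    have e2 : B v (F x - A v) ≤ d / 2 * ‖v‖ ^ 2 := by
      calc B v (F x - A v) ≤ b * ‖v‖ * ‖F x - A v‖ := hBle _ _
        _ ≤ b * ‖v‖ * (d / (2 * b) * ‖v‖) := by gcongr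
        _ = d / 2 * ‖v‖ ^ 2 := by field_simp
    have e3 : κ * B v v ≤ d / 2 * ‖v‖ ^ 2 := by
      calc κ * B v v ≤ κ * (b * ‖v‖ * ‖v‖) := by gcongr; exact hBle _ _
        _ = d / 2 * ‖v‖ ^ 2 := by rw [hκ]; field_simp
    have e4 := hdB v
    have e5 : 0 < d * ‖v‖ ^ 2 := by positivity
    linarith
  obtain ⟨r, hr, hrball⟩ := Metric.eventually_nhds_iff_ball.mp
    (hnear.and (hF.eventually (by simp)))
  -- A bump function cuts `F` off to a globally Lipschitz field.
  let f : ContDiffBump xe := ⟨r / 4, r / 2, by positivity, by linarith⟩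
  let Fc : E → E := fun x => f x • F x
  have hFc_eq : ∀ x ∈ Metric.closedBall xe (r / 4), Fc x = F x := fun x hx => by
    simp [Fc, f.one_of_mem_closedBall hx]
  have hFc_supp : HasCompactSupport Fc := f.hasCompactSupport.smul_right
  have hFc_diff : ContDiff ℝ 1 Fc := by
    rw [contDiff_iff_contDiffAt]
    intro x
    by_cases hx : x ∈ Metric.ball xe r
    · exact f.contDiffAt.smul (hrball x hx).2
    · have hx' : x ∉ tsupport f := by
        rw [f.tsupport_eq]
        intro h
        exact hx (Metric.closedBall_subset_ball (by simp [f]; linarith) h)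
      have : Fc =ᶠ[𝓝 x] fun _ => 0 := by
        filter_upwards [notMem_tsupport_iff_eventuallyEq.mp hx'] with y hy
        simp [Fc, hy]
      exact contDiffAt_const.congr_of_eventuallyEq this
  obtain ⟨K, hK⟩ := hFc_diff.lipschitzWith_of_hasCompactSupport hFc_supp one_ne_zero
  obtain ⟨L, hL⟩ := hFc_supp.exists_bound_of_continuous hFc_diff.continuous
  have hL' : ∀ x, ‖Fc x‖ ≤ (L.toNNReal : ℝ) := fun x => (hL x).trans (Real.le_coe_toNNReal L)
  have hsublevel : ∀ ρ > 0, ∀ x, B (x - xe) (x - xe) ≤ c * ρ ^ 2 / 2 → x ∈ Metric.ball xe ρ := by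
    intro ρ hρ x hx
    rw [mem_ball_iff_norm]
    have h1 := hcB (x - xe)
    have h2 : 0 < c * ρ ^ 2 := by positivity
    have h3 : c * ‖x - xe‖ ^ 2 < c * ρ ^ 2 := by linarith
    exact lt_of_pow_lt_pow_left₀ 2 hρ.le (lt_of_mul_lt_mul_left h3 hc.le)
  -- Decay for every field that agrees with `F` on the ball of radius `r / 4`.
  have hdecay : ∀ G : E → E, (∀ x ∈ Metric.closedBall xe (r / 4), G x = F x) →
      ∀ ρ > 0, ρ ≤ r / 4 → ∀ (T : ℝ) (x : ℝ → E), IsSolutionOn G (Set.Ico 0 T) x →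
        B (x 0 - xe) (x 0 - xe) ≤ c * ρ ^ 2 / 2 → ∀ t ∈ Set.Ico 0 T,
          B (x t - xe) (x t - xe) ≤ c * ρ ^ 2 / 2 * Real.exp (-κ * t) := by
    intro G hG ρ hρ hρr T x hx hx0 t ht
    refine lyapunov_le_exp (F := G) hs hκ0.le (by positivity) (fun y hy1 hy2 => ?_) hx hx0 ht
    have hy := hsublevel ρ hρ y hy2
    rw [hG y (Metric.ball_subset_closedBall (Metric.ball_subset_ball hρr hy))]
    exact (hrball y (Metric.ball_subset_ball (by linarith) hy)).1 hy1
  have hstart : ∀ ρ > 0, ∃ δ > 0, ∀ x₀ ∈ Metric.ball xe δ,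
      B (x₀ - xe) (x₀ - xe) ≤ c * ρ ^ 2 / 2 := by
    intro ρ hρ
    have hcont : ContinuousAt (fun x => B (x - xe) (x - xe)) xe := by fun_prop
    have : ∀ᶠ x in 𝓝 xe, B (x - xe) (x - xe) < c * ρ ^ 2 / 2 :=
      hcont.eventually (gt_mem_nhds (by simp; positivity))
    obtain ⟨δ, hδ, h⟩ := Metric.eventually_nhds_iff_ball.mp this
    exact ⟨δ, hδ, fun x hx => (h x hx).le⟩
  have hexp_le : ∀ ρ : ℝ, ∀ t, 0 ≤ t →
      c * ρ ^ 2 / 2 * Real.exp (-κ * t) ≤ c * ρ ^ 2 / 2 := fun ρ t ht =>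
    mul_le_of_le_one_right (by positivity) (Real.exp_le_one_iff.mpr (by nlinarith))
  refine ⟨h0, fun ε hε => ?_, ?_⟩
  · have hρ : 0 < min ε (r / 4) := by positivity
    obtain ⟨δ, hδ, hδB⟩ := hstart _ hρ
    refine ⟨δ, hδ, fun x₀ hx₀ => ⟨?_, fun T _ x hx hx0 t ht => ?_⟩⟩
    · obtain ⟨x, hx, hx0⟩ := exists_isSolutionOn_of_lipschitzWith_of_bounded hK hL' x₀
      refine ⟨x, fun t ht => ?_, hx0⟩
      have ht' : (0 : ℝ) ≤ t := ht
      have h1 := hdecay Fc hFc_eq _ hρ (min_le_right _ _) (t + 1) x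
        (hx.mono Set.Ico_subset_Ici_self) (hx0 ▸ hδB x₀ hx₀) t ⟨ht', by linarith⟩
      have h2 := hsublevel _ hρ _ (h1.trans (hexp_le _ t ht'))
      have h3 := hFc_eq _ (Metric.ball_subset_closedBall
        (Metric.ball_subset_ball (min_le_right _ _) h2))
      rw [← h3]
      exact hx t ht
    · have h1 := hdecay F (fun _ _ => rfl) _ hρ (min_le_right _ _) T x hx (hx0 ▸ hδB x₀ hx₀) t ht
      exact Metric.ball_subset_ball (min_le_left _ _)
        (hsublevel _ hρ _ (h1.trans (hexp_le _ t ht.1)))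
  · have hρ : 0 < r / 4 := by positivity
    obtain ⟨δ, hδ, hδB⟩ := hstart _ hρ
    refine ⟨δ, hδ, fun x hx hx0 => ?_⟩
    have hB0 : Tendsto (fun t => c⁻¹ * (c * (r / 4) ^ 2 / 2 * Real.exp (-κ * t))) atTop (𝓝 0) := by
      have h1 : Tendsto (fun t => -κ * t) atTop atBot :=
        tendsto_id.const_mul_atTop_of_neg (neg_lt_zero.mpr hκ0)
      have h2 := ((Real.tendsto_exp_atBot.comp h1).const_mul (c * (r / 4) ^ 2 / 2)).const_mul c⁻¹
      simpa using h2
    have hsq : Tendsto (fun t => ‖x t - xe‖ ^ 2) atTop (𝓝 0) := by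
      refine squeeze_zero' (.of_forall fun t => by positivity) ?_ hB0
      filter_upwards [eventually_ge_atTop 0] with t ht
      have h1 := hdecay F (fun _ _ => rfl) _ hρ le_rfl (t + 1) x (hx.mono Set.Ico_subset_Ici_self)
        (hδB _ hx0) t ⟨ht, by linarith⟩
      rw [le_inv_mul_iff₀ hc]
      exact (hcB _).trans h1
    rw [tendsto_iff_norm_sub_tendsto_zero]
    have := hsq.sqrt
    simpa using this

end Stability

/-! ### The linearized network -/

section Components

variable {n : ℕ} (zd sd zq sq : Fin n → ℝ) (i : Fin n)

theorem mkState_zd : mkState zd sd zq sq (Sum.inl (Sum.inl i)) = zd i := rfl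

theorem mkState_sd : mkState zd sd zq sq (Sum.inl (Sum.inr i)) = sd i := rfl

theorem mkState_zq : mkState zd sd zq sq (Sum.inr (Sum.inl i)) = zq i := rfl

theorem mkState_sq : mkState zd sd zq sq (Sum.inr (Sum.inr i)) = sq i := rfl

end Components

namespace Network

variable {n m : ℕ} (N : Network n m) (G : Gains n)

/-- The quadratic form of the Laplacian is the sum of the line terms
`(ω_g L_e - r_e)⁻¹ (B z)_e²`. -/
theorem laplacian_transpose_form_nonneg (hline : ∀ e, N.r e < N.wg * N.ind e) (z : Fin n → ℝ) :
    0 ≤ ∑ i, z i * N.laplacian.transpose.mulVec z i := by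
  have hinv : (-Matrix.diagonal N.r + N.wg • Matrix.diagonal N.ind)⁻¹ =
      Matrix.diagonal fun e => (-N.r e + N.wg * N.ind e)⁻¹ := by
    refine Matrix.inv_eq_left_inv ?_
    rw [← Matrix.diagonal_smul, Matrix.diagonal_neg, Matrix.diagonal_add,
      Matrix.diagonal_mul_diagonal, ← Matrix.diagonal_one]
    congr 1
    ext e
    have : -N.r e + N.wg * N.ind e ≠ 0 := by linarith [hline e]
    simpa using inv_mul_cancel₀ this
  have h : ∑ i, z i * N.laplacian.transpose.mulVec z i =
      ∑ e, (-N.r e + N.wg * N.ind e)⁻¹ * (N.incidence.mulVec z e) ^ 2 := by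
    change z ⬝ᵥ N.laplacian.transpose.mulVec z = _
    rw [laplacian, hinv, Matrix.transpose_mul, Matrix.transpose_mul, Matrix.transpose_transpose,
      Matrix.diagonal_transpose, ← Matrix.mulVec_mulVec, Matrix.dotProduct_mulVec,
      Matrix.vecMul_transpose, ← Matrix.mulVec_mulVec]
    refine Finset.sum_congr rfl fun e _ => ?_
    rw [Matrix.mulVec_diagonal]
    ring
  rw [h]
  refine Finset.sum_nonneg fun e _ => mul_nonneg (inv_nonneg.mpr ?_) (sq_nonneg _)
  linarith [hline e]

theorem contDiffAt_closedLoop {zhat shat : Fin n → ℝ} (hvolt : ∀ i, zhat i + N.zo i ≠ 0) :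
    ContDiffAt ℝ 1 (N.closedLoop G zhat) (mkState zhat shat 0 0) := by
  have hden : ∀ i, (mkState zhat shat 0 0 (Sum.inl (Sum.inl i)) + N.zo i) ^ 2 +
      mkState zhat shat 0 0 (Sum.inr (Sum.inl i)) ^ 2 ≠ 0 := fun i => by
    have := hvolt i
    simpa [mkState] using this
  rw [contDiffAt_pi]
  rintro ((i | i) | (i | i))
  all_goals
    simp only [closedLoop, mkState_zd, mkState_sd, mkState_zq, mkState_sq, inputD, inputQ,
      loadD, loadQ, State.zd, State.sd, State.zq, State.sq,
      Matrix.mulVec, dotProduct]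
    have := hden i
    fun_prop (disch := assumption)

/-- The matrix `k + 𝓛ᵀ` that damps the voltages under proportional control with gains `k`. -/
def loopMatrix (k : Fin n → ℝ) : Matrix (Fin n) (Fin n) ℝ :=
  Matrix.diagonal k + N.laplacian.transpose

theorem loopMatrix_form_pos (hline : ∀ e, N.r e < N.wg * N.ind e) {k : Fin n → ℝ}
    (hk : ∀ i, 0 < k i) {z : Fin n → ℝ} (hz : z ≠ 0) :
    0 < ∑ i, z i * (N.loopMatrix k).mulVec z i := by
  have h1 := diagForm_self_pos hk hz
  have h2 := N.laplacian_transpose_form_nonneg hline z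
  have h3 : ∑ i, z i * (N.loopMatrix k).mulVec z i =
      diagForm k z z + ∑ i, z i * N.laplacian.transpose.mulVec z i := by
    rw [diagForm_apply, ← Finset.sum_add_distrib]
    refine Finset.sum_congr rfl fun i _ => ?_
    rw [loopMatrix, Matrix.add_mulVec, Pi.add_apply, Matrix.mulVec_diagonal]
    ring
  linarith

theorem hasDerivAt_loadD_line {a p q P Q : ℝ} (ha : a ≠ 0) :
    HasDerivAt (fun t : ℝ => loadD (a + t * p) (t * q) P Q)
      (2 / 3 * (-(P / a ^ 2) * p + Q / a ^ 2 * q)) 0 := by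
  have h1 : HasDerivAt (fun t : ℝ => a + t * p) p 0 := by
    simpa using ((hasDerivAt_id (0 : ℝ)).mul_const p).const_add a
  have h2 : HasDerivAt (fun t : ℝ => t * q) q 0 := by
    simpa using (hasDerivAt_id (0 : ℝ)).mul_const q
  have h3 := (h1.pow 2).add (h2.pow 2)
  have h4 : ((fun t : ℝ => a + t * p) ^ 2 + (fun t : ℝ => t * q) ^ 2) 0 ≠ 0 := by simpa using ha
  refine ((((h1.div h3 h4).mul_const P).add ((h2.div h3 h4).mul_const Q)).const_mul
    (2 / 3)).congr_deriv ?_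
  simp
  field_simp
  ring

/-- The derivative of the closed loop at an equilibrium. In the `q`-block the load current and the
cross-coupling have been cancelled by the controller, so that `z̃_d` and `σ_d` do not enter. -/
theorem fderiv_closedLoop_apply {zhat shat : Fin n → ℝ}
    (hvolt : ∀ i, zhat i + N.zo i ≠ 0) (v : State n) :
    fderiv ℝ (N.closedLoop G zhat) (mkState zhat shat 0 0) v = mkState
      (fun i => (N.C i)⁻¹ *
        (-(N.loopMatrix fun i => G.Kd i - 2 / 3 * (N.P i / (zhat i + N.zo i) ^ 2)).mulVec v.zd i
          + G.M i * v.sd i + (N.wg * N.C i - 2 / 3 * (N.Q i / (zhat i + N.zo i) ^ 2)) * v.zq i))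
      (fun i => -(G.kId i * (1 - shat i ^ 2)) * v.zd i)
      (fun i => (N.C i)⁻¹ * (-(N.loopMatrix G.Kq).mulVec v.zq i + 1 * v.sq i))
      (fun i => -G.kIq i * v.zq i) := by
  have hA := ((N.contDiffAt_closedLoop G (shat := shat) hvolt).differentiableAt
    one_ne_zero).hasFDerivAt
  set A := fderiv ℝ (N.closedLoop G zhat) (mkState zhat shat 0 0)
  have hl : HasDerivAt (fun t : ℝ => mkState zhat shat 0 0 + t • v) v 0 := by
    simpa using ((hasDerivAt_id (0 : ℝ)).smul_const v).const_add (mkState zhat shat 0 0)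
  have hA' : HasFDerivAt (N.closedLoop G zhat) A (mkState zhat shat 0 0 + (0 : ℝ) • v) := by
    simpa using hA
  have hline := hasDerivAt_pi.mp (hA'.comp_hasDerivAt (0 : ℝ) hl)
  have ezd : ∀ t : ℝ, State.zd (mkState zhat shat 0 0 + t • v) = zhat + t • v.zd := fun t => rfl
  have esd : ∀ t : ℝ, State.sd (mkState zhat shat 0 0 + t • v) = shat + t • v.sd := fun t => rfl
  have ezq : ∀ t : ℝ, State.zq (mkState zhat shat 0 0 + t • v) = t • v.zq := fun t => by
    funext i
    simp [State.zq, mkState]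
  have esq : ∀ t : ℝ, State.sq (mkState zhat shat 0 0 + t • v) = t • v.sq := fun t => by
    funext i
    simp [State.sq, mkState]
  have hlin : ∀ a b : ℝ, HasDerivAt (fun t : ℝ => a + t * b) b 0 := fun a b => by
    simpa using ((hasDerivAt_id (0 : ℝ)).mul_const b).const_add a
  funext k
  refine (hline k).unique ?_
  rcases k with ((i | i) | (i | i))
  · have h := (((hlin (-G.Kd i * zhat i + G.M i * shat i - N.laplacian.transpose.mulVec zhat i)
      (-G.Kd i * v.zd i + G.M i * v.sd i + N.wg * N.C i * v.zq i
        - N.laplacian.transpose.mulVec v.zd i)).sub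
      (hasDerivAt_loadD_line (p := v.zd i) (q := v.zq i) (P := N.P i) (Q := N.Q i)
        (hvolt i))).const_mul (N.C i)⁻¹)
    refine (h.congr_deriv ?_).congr_of_eventuallyEq (.of_forall fun t => ?_)
    · simp only [mkState, Sum.elim_inl, loopMatrix, Matrix.add_mulVec, Pi.add_apply,
        Matrix.mulVec_diagonal]
      ring
    · simp only [Function.comp_apply, closedLoop, mkState_zd, inputD,
        ezd, esd, ezq, Matrix.mulVec_add, Matrix.mulVec_smul, Pi.add_apply, Pi.smul_apply,
        smul_eq_mul, Pi.sub_apply]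
      rw [show zhat i + t * v.zd i + N.zo i = zhat i + N.zo i + t * v.zd i by ring]
      ring
  · have h := ((((hlin (shat i) (v.sd i)).pow 2).const_sub 1).const_mul (G.kId i)).mul
      ((hlin (zhat i) (v.zd i)).const_sub (zhat i))
    refine (h.congr_deriv ?_).congr_of_eventuallyEq (.of_forall fun t => ?_)
    · simp [mkState]
    · simp only [Function.comp_apply, closedLoop, mkState_sd, ezd, esd, Pi.add_apply, Pi.smul_apply,
        smul_eq_mul, Pi.mul_apply,
        Pi.pow_apply]
  · have h := hlin 0 ((N.C i)⁻¹ * (-(N.loopMatrix G.Kq).mulVec v.zq i + 1 * v.sq i))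
    refine h.congr_of_eventuallyEq (.of_forall fun t => ?_)
    simp only [Function.comp_apply, closedLoop, mkState_zq, inputQ, ezd, ezq, esq, loopMatrix,
      Matrix.add_mulVec, Matrix.mulVec_smul,
      Pi.add_apply, Pi.smul_apply, smul_eq_mul, Matrix.mulVec_diagonal]
    ring
  · have h := hlin 0 (-G.kIq i * v.zq i)
    refine h.congr_of_eventuallyEq (.of_forall fun t => ?_)
    simp only [Function.comp_apply, closedLoop, mkState_sq, ezq,
      Pi.smul_apply, smul_eq_mul]
    ring

/-- The linearization is a cascade of two proportional-integral loops, the `q`-loop driving the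
`d`-loop. The constant power loads lower the proportional gain of the `d`-loop to
`K_d - 2/3 P / (ẑ_d + z°)²`, which the gain condition keeps positive. -/
theorem hasLyapunovForm_fderiv_closedLoop (hline : ∀ e, N.r e < N.wg * N.ind e)
    (hC : ∀ i, 0 < N.C i) (hkId : ∀ i, 0 < G.kId i) (hM : ∀ i, 0 < G.M i)
    (hKq : ∀ i, 0 < G.Kq i) (hkIq : ∀ i, 0 < G.kIq i) {zhat shat : Fin n → ℝ}
    (hvolt : ∀ i, zhat i + N.zo i ≠ 0) (hshat : ∀ i, shat i ∈ Set.Ioo (-1 : ℝ) 1)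
    (hgain : ∀ i, G.Kd i > 2 / 3 * (N.P i / (zhat i + N.zo i) ^ 2)) :
    HasLyapunovForm (fderiv ℝ (N.closedLoop G zhat) (mkState zhat shat 0 0)) := by
  have hd := hasLyapunovForm_piLoop (E := fun i => G.kId i * (1 - shat i ^ 2)) hC hM
    (fun i => mul_pos (hkId i) (by nlinarith [(hshat i).1, (hshat i).2]))
    (fun z => N.loopMatrix_form_pos hline (fun i => sub_pos.mpr (hgain i)))
  have hq := hasLyapunovForm_piLoop (D := fun _ => 1) hC (fun _ => one_pos) hkIq
    (fun z => N.loopMatrix_form_pos hline hKq)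
  let X : (Fin n → ℝ) × (Fin n → ℝ) →L[ℝ] (Fin n → ℝ) × (Fin n → ℝ) :=
    LinearMap.toContinuousLinearMap
      { toFun := fun w => (fun i => (N.C i)⁻¹ *
          ((N.wg * N.C i - 2 / 3 * (N.Q i / (zhat i + N.zo i) ^ 2)) * w.1 i), 0)
        map_add' := fun v w => by
          ext i <;> simp
          ring
        map_smul' := fun a v => by
          ext i <;> simp
          ring }
  let J : State n →L[ℝ] ((Fin n → ℝ) × (Fin n → ℝ)) × ((Fin n → ℝ) × (Fin n → ℝ)) :=
    LinearMap.toContinuousLinearMap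
      { toFun := fun v => ((v.zd, v.sd), (v.zq, v.sq))
        map_add' := fun _ _ => rfl
        map_smul' := fun _ _ => rfl }
  have hJ : ∀ v, J v = ((v.zd, v.sd), (v.zq, v.sq)) := fun v => rfl
  refine (hd.cascade hq X).of_injective J (fun v w h => ?_) (fun v => ?_)
  · simp only [hJ, Prod.mk.injEq] at h
    funext k
    rcases k with ((i | i) | (i | i))
    · exact congrFun h.1.1 i
    · exact congrFun h.1.2 i
    · exact congrFun h.2.1 i
    · exact congrFun h.2.2 i
  · rw [N.fderiv_closedLoop_apply G hvolt, hJ, hJ]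
    ext i
    · simp [Microgrid.cascade, piLoop, X, State.zd, mkState]
      ring
    · simp [Microgrid.cascade, piLoop, X, State.sd, State.zd, mkState]
    · simp [Microgrid.cascade, piLoop, State.zq, State.sq, mkState]
    · simp [Microgrid.cascade, piLoop, State.zq, State.sq, mkState]

theorem jacobian_closedLoop_toBlocks₂₁ {zhat shat : Fin n → ℝ}
    (hvolt : ∀ i, zhat i + N.zo i ≠ 0) :
    (jacobian (N.closedLoop G zhat) (mkState zhat shat 0 0)).toBlocks₂₁ = 0 := by
  ext k l
  rw [Matrix.toBlocks₂₁, Matrix.of_apply, jacobian, LinearMap.toMatrix'_apply,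
    ContinuousLinearMap.coe_coe, N.fderiv_closedLoop_apply G hvolt]
  have hz : State.zq (Pi.single (Sum.inl l) 1 : State n) = 0 := by
    funext i
    simp [State.zq]
  have hs : State.sq (Pi.single (Sum.inl l) 1 : State n) = 0 := by
    funext i
    simp [State.sq]
  rcases k with i | i <;> simp [mkState, hz, hs]

end Network

end Microgrid

end

theorem proposition2 {n m : ℕ} (N : Microgrid.Network n m) (G : Microgrid.Gains n)
    (hloop : ∀ e, N.src e ≠ N.tgt e)
    (hline : ∀ e, N.r e < N.wg * N.ind e)
    (hC : ∀ i, 0 < N.C i)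
    (hKd : ∀ i, 0 < G.Kd i) (hkId : ∀ i, 0 < G.kId i) (hM : ∀ i, 0 < G.M i)
    (hKq : ∀ i, 0 < G.Kq i) (hkIq : ∀ i, 0 < G.kIq i)
    (zhat shat : Fin n → ℝ)
    (hvolt : ∀ i, zhat i + N.zo i ≠ 0)
    (hequil : N.closedLoop G zhat (Microgrid.mkState zhat shat 0 0) = 0)
    (hshat : ∀ i, shat i ∈ Set.Ioo (-1 : ℝ) 1)
    (hgain : ∀ i, G.Kd i > 2 / 3 * (N.P i / (zhat i + N.zo i) ^ 2)) :
    DifferentiableAt ℝ (N.closedLoop G zhat) (Microgrid.mkState zhat shat 0 0) ∧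
    (Microgrid.jacobian (N.closedLoop G zhat) (Microgrid.mkState zhat shat 0 0)).toBlocks₂₁ = 0 ∧
    Microgrid.IsHurwitz
      (Microgrid.jacobian (N.closedLoop G zhat) (Microgrid.mkState zhat shat 0 0)) ∧
    Microgrid.IsLocallyAsymptoticallyStable (N.closedLoop G zhat)
      (Microgrid.mkState zhat shat 0 0) := by
  have hdiff := N.contDiffAt_closedLoop G (shat := shat) hvolt
  have hlyap := N.hasLyapunovForm_fderiv_closedLoop G hline hC hkId hM hKq hkIq hvolt hshat hgain
  exact ⟨hdiff.differentiableAt one_ne_zero, N.jacobian_closedLoop_toBlocks₂₁ G hvolt,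
    hlyap.isHurwitz, hlyap.isLocallyAsymptoticallyStable hdiff hequil⟩
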